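/- Let $0\le r<R<\infty$ and $0\le r_*<R_*<\infty$, and write $\mathbb{A}(a,b)=\{x\in\mathbf{R}^3: a<|x|<b\}$. Let $\|L\|^2=\mathrm{Tr}(L^*L)$ denote the squared Hilbert–Schmidt norm of a linear map $L$ of $\mathbf{R}^3$, let $\mathbb{S}(t)$ be the sphere of radius $t$ about $0$, let $\mathbb{S}=\mathbb{S}(1)$, and let $\sigma$ be surface area measure. (i) If $f$ is a homeomorphism of $\mathbb{A}(r,R)$ onto $\mathbb{A}(r_*,R_*)$ of class $C^1$, and $S=f/|f|$, then for every $t\in(r,R)$ $$\int_{\mathbb{S}(t)}\Bigl(\|DS(x)\|^2-\Bigl|DS(x)\frac{x}{|x|}\Bigr|^2\Bigr)\,d\sigma(x)\ \ge\ 8\pi .$$ (ii) The inequality is sharp: there is a $C^1$ homeomorphism $f$ of $\mathbb{A}(r,R)$ onto $\mathbb{A}(r_*,R_*)$ for which equality holds for every $t\in(r,R)$. (iii) Equality holds for every $t\in(r,R)$ whenever $f$ is a $C^1$ homeomorphism of $\mathbb{A}(r,R)$ onto $\mathbb{A}(r_*,R_*)$ of the form $f(x)=\rho(|x|)\,T(x/|x|)$,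 where $\rho$ is a real function and $T$ is a conformal transformation of $\mathbb{S}$, that is, a $C^1$ bijection of $\mathbb{S}$ onto itself whose differential at every point is a positive multiple of a linear isometry between tangent planes (orientation may be preserved or reversed). Moreover, for every such $T$ there is a $\rho$ for which $x\mapsto\rho(|x|)\,T(x/|x|)$ is a $C^1$ homeomorphism of $\mathbb{A}(r,R)$ onto $\mathbb{A}(r_*,R_*)$. -/

import Mathlib

open MeasureTheory Set Metric

noncomputable section

/-- Euclidean three-space. -/
abbrev E3 : Type := EuclideanSpace ℝ (Fin 3)

/-- The open spherical ring with inner radius `r` and outer radius `R`. -/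
def ring3 (r R : ℝ) : Set E3 := {x | r < ‖x‖ ∧ ‖x‖ < R}

/-- `f` restricts to a homeomorphism of `A` onto `B` that is of class `C¹` on the open set `A`. -/
structure IsC1HomeoOn (f : E3 → E3) (A B : Set E3) : Prop where
  contDiffOn : ContDiffOn ℝ 1 f A
  bijOn : BijOn f A B
  continuousOn_inv : ContinuousOn (Function.invFunOn f A) B

/-- The direction `x / |x|` of `x`. -/
def dir (x : E3) : E3 := ‖x‖⁻¹ • x

/-- The spherical part `S = f / |f|` of `f`. -/
def sphericalPart (f : E3 → E3) (x : E3) : E3 := dir (f x)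

/-- The square `Tr (L* L)` of the Hilbert–Schmidt norm of `L`. -/
def hsNormSq (L : E3 →L[ℝ] E3) : ℝ :=
  LinearMap.trace ℝ E3 (L.adjoint ∘L L : E3 →L[ℝ] E3)

/-- The surface area measure of the sphere of radius `t > 0` about the origin, as a measure on
`E3`: the image under `η ↦ t η` of the surface measure of the unit sphere, times `t²`. -/
def sphereMeasure (t : ℝ) : Measure E3 :=
  ENNReal.ofReal (t ^ 2) •
    (volume : Measure E3).toSphere.map (fun η : sphere (0 : E3) 1 => t • (η : E3))

/-- The integral of `‖DS‖² - |DS(x) x/|x||²` over the sphere of radius `t`, for `S = f / |f|`. -/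
def tangentialEnergy (f : E3 → E3) (t : ℝ) : ℝ :=
  ∫ x, (hsNormSq (fderiv ℝ (sphericalPart f) x)
    - ‖fderiv ℝ (sphericalPart f) x (dir x)‖ ^ 2) ∂(sphereMeasure t)

/-- `T` restricts to a conformal transformation of the unit sphere: a bijection of the sphere onto
itself, of class `C¹`, whose differential at each point is a similarity between tangent planes.
Only the values of `T` on the sphere matter: regularity and differential are read off from the
extension `x ↦ T (x / |x|)`, which is constant on rays; the tangent plane at `x` is the orthogonal
complement of `x`. Orientation may be preserved or reversed. -/
structure IsSphereConformal (T : E3 → E3) : Prop where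
  bijOn : BijOn T (sphere 0 1) (sphere 0 1)
  contDiffOn : ContDiffOn ℝ 1 (fun x => T (dir x)) {0}ᶜ
  conformal : ∀ x ∈ sphere (0 : E3) 1,
    IsConformalMap ((fderiv ℝ (fun y => T (dir y)) x) ∘L (ℝ ∙ x)ᗮ.subtypeL)

end

/-! ### Hilbert–Schmidt norm and determinant in an orthonormal basis -/

section LinearAlgebra

/-! Fix `t` and put `u x = S (t • dir x)`, a map to the unit sphere that is constant on rays. The
tangential energy is scale invariant, so over the sphere of radius `t` it equals the integral of
`‖Du‖²` over the unit sphere (`IsC1HomeoOn.tangentialEnergy_eq`). To replace surface Jacobians by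
determinants in `E3`, extend `u` to the cone map `F x = ‖x‖ • u x`. Hadamard's inequality and AM-GM
give `2 |det DF| ≤ ‖Du‖²` on the unit sphere, so in polar coordinates the energy is at least `6 ∫
|det DF|` over the unit ball, hence at least six times the volume of the image of `F`. If `u` is
onto the sphere, this image fills the punctured ball, and `6 · 4π/3 = 8π`. If `u` is a conformal
bijection, every inequality is an equality.

Surjectivity of `u` (`IsC1HomeoOn.exists_dir_eq`) needs only connectedness and compactness. The
image of the sphere of radius `t` lies in a compact shell, and off that shell the function `‖f⁻¹‖ -
t` keeps one sign on the inner side and one on the outer side. Equal signs would bound `‖f⁻¹‖` away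
from `r` or from `R`; opposite signs force a zero on every ray. -/

lemma hsNormSq_eq_sum (b : OrthonormalBasis (Fin 3) ℝ E3) (L : E3 →L[ℝ] E3) :
    hsNormSq L = ∑ i, ‖L (b i)‖ ^ 2 := by
  rw [hsNormSq, LinearMap.trace_eq_sum_inner _ b]
  refine Finset.sum_congr rfl fun i _ => ?_
  simp [ContinuousLinearMap.adjoint_inner_right]

lemma exists_orthonormalBasis_zero_eq {η : E3} (hη : ‖η‖ = 1) :
    ∃ b : OrthonormalBasis (Fin 3) ℝ E3, b 0 = η := by
  have h : Orthonormal ℝ (({0} : Set (Fin 3)).domRestrict fun _ => η) := by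
    refine ⟨fun i => hη, fun i j hij => (hij (Subsingleton.elim _ _)).elim⟩
  obtain ⟨b, hb⟩ := h.exists_orthonormalBasis_extension_of_card_eq (by simp)
  exact ⟨b, hb 0 rfl⟩

lemma abs_det_eq_abs_volumeForm (b : OrthonormalBasis (Fin 3) ℝ E3) (L : E3 →L[ℝ] E3)
    [Fact (Module.finrank ℝ E3 = 3)] :
    |L.det| = |b.toBasis.orientation.volumeForm fun i => L (b i)| := by
  rw [Orientation.volumeForm_robust _ b rfl]
  have h := b.toBasis.det_comp (L : E3 →ₗ[ℝ] E3) b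
  have h1 : b.toBasis.det b = 1 := by
    simpa using b.toBasis.det_self
  rw [h1, mul_one] at h
  rw [ContinuousLinearMap.det, ← h]
  rfl

/-- Hadamard's inequality for the determinant of an endomorphism of `E3`. -/
lemma abs_det_le_prod_norm (b : OrthonormalBasis (Fin 3) ℝ E3) (L : E3 →L[ℝ] E3) :
    |L.det| ≤ ∏ i, ‖L (b i)‖ := by
  have : Fact (Module.finrank ℝ E3 = 3) := ⟨by simp⟩
  rw [abs_det_eq_abs_volumeForm b]
  exact Orientation.abs_volumeForm_apply_le _ _

lemma abs_det_eq_prod_norm (b : OrthonormalBasis (Fin 3) ℝ E3) (L : E3 →L[ℝ] E3)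
    (h : Pairwise fun i j => inner ℝ (L (b i)) (L (b j)) = 0) :
    |L.det| = ∏ i, ‖L (b i)‖ := by
  have : Fact (Module.finrank ℝ E3 = 3) := ⟨by simp⟩
  rw [abs_det_eq_abs_volumeForm b]
  exact Orientation.abs_volumeForm_apply_of_pairwise_orthogonal _ h

lemma continuous_hsNormSq : Continuous hsNormSq := by
  have : hsNormSq = fun L => ∑ i, ‖L (EuclideanSpace.basisFun (Fin 3) ℝ i)‖ ^ 2 :=
    funext fun L => hsNormSq_eq_sum _ L
  rw [this]
  fun_prop

lemma hsNormSq_nonneg (L : E3 →L[ℝ] E3) : 0 ≤ hsNormSq L := by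
  rw [hsNormSq_eq_sum (EuclideanSpace.basisFun (Fin 3) ℝ)]
  positivity

end LinearAlgebra

/-! ### The radial projection and its derivative -/

section Direction

lemma norm_dir {x : E3} (hx : x ≠ 0) : ‖dir x‖ = 1 := by
  rw [dir, norm_smul, norm_inv, norm_norm, inv_mul_cancel₀ (norm_ne_zero_iff.2 hx)]

lemma norm_smul_dir (x : E3) : ‖x‖ • dir x = x := by
  rcases eq_or_ne x 0 with rfl | hx
  · simp [dir]
  · rw [dir, smul_inv_smul₀ (norm_ne_zero_iff.2 hx)]

lemma dir_smul {s : ℝ} (hs : 0 < s) (x : E3) : dir (s • x) = dir x := by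
  rw [dir, dir, norm_smul, Real.norm_of_nonneg hs.le, smul_smul, mul_inv, mul_comm s⁻¹, mul_assoc,
    inv_mul_cancel₀ hs.ne', mul_one]

lemma dir_of_norm_eq_one {x : E3} (hx : ‖x‖ = 1) : dir x = x := by simp [dir, hx]

lemma contDiffOn_dir : ContDiffOn ℝ 1 dir {0}ᶜ := by
  intro x hx
  have hx : x ≠ 0 := hx
  have h : ContDiffAt ℝ 1 (fun y : E3 => ‖y‖⁻¹ • y) x :=
    ((contDiffAt_norm ℝ hx).inv (norm_ne_zero_iff.2 hx)).smul contDiffAt_id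
  exact h.contDiffWithinAt

lemma differentiableAt_dir {x : E3} (hx : x ≠ 0) : DifferentiableAt ℝ dir x :=
  (contDiffOn_dir.contDiffAt (isOpen_compl_singleton.mem_nhds hx)).differentiableAt (by simp)

lemma continuousOn_dir : ContinuousOn dir {0}ᶜ := contDiffOn_dir.continuousOn

lemma measurable_dir : Measurable dir := by
  unfold dir
  fun_prop

lemma hasFDerivAt_norm_of_norm_eq_one {η : E3} (hη : ‖η‖ = 1) :
    HasFDerivAt (fun x : E3 => ‖x‖) (innerSL ℝ η) η := by
  have h := (hasStrictFDerivAt_norm_sq η).hasFDerivAt.sqrt (by simp [hη])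
  refine (h.congr_of_eventuallyEq (.of_forall fun x => ?_)).congr_fderiv ?_
  · simp
  · ext v
    simp [hη]

lemma fderiv_norm_smul_apply {u : E3 → E3} {η : E3} (hη : ‖η‖ = 1) (hu : DifferentiableAt ℝ u η)
    (v : E3) : fderiv ℝ (fun x => ‖x‖ • u x) η v = fderiv ℝ u η v + inner ℝ η v • u η := by
  have h := (hasFDerivAt_norm_of_norm_eq_one hη).smul hu.hasFDerivAt
  have h' : HasFDerivAt (fun x => ‖x‖ • u x) _ η := h
  rw [h'.fderiv]
  simp [hη]

/-- Differentiate the identity `‖x‖ • dir x = x` by the product rule and solve for the derivative of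
`dir`: the orthogonal projection along `η`. -/
lemma fderiv_dir_apply {η : E3} (hη : ‖η‖ = 1) (v : E3) :
    fderiv ℝ dir η v = v - inner ℝ η v • η := by
  have hη0 : η ≠ 0 := by rintro rfl; simp at hη
  have h := fderiv_norm_smul_apply hη (differentiableAt_dir hη0) v
  simp only [norm_smul_dir, fderiv_fun_id, dir_of_norm_eq_one hη] at h
  rw [eq_sub_iff_add_eq, ← h]
  rfl

end Direction

/-! ### Surface measure as cone volume -/

section Polar

open scoped Pointwise ENNReal

/-- The punctured open unit ball. -/
abbrev puncturedBall : Set E3 := ball 0 1 \ {0}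

lemma measurableSet_puncturedBall : MeasurableSet puncturedBall :=
  measurableSet_ball.diff (measurableSet_singleton 0)

lemma volume_puncturedBall : volume puncturedBall = ENNReal.ofReal (4 * Real.pi / 3) := by
  rw [measure_sdiff_null (measure_singleton _), EuclideanSpace.volume_ball_fin_three]
  rw [← ENNReal.ofReal_pow zero_le_one, ← ENNReal.ofReal_mul (by norm_num)]
  congr 1
  ring

/-- `toSphere` measures a set by the dimension, 3, times the volume of the cone over it, and that
cone is the part of the punctured ball whose direction lies in the set. -/
lemma map_val_toSphere :
    (volume : Measure E3).toSphere.map (Subtype.val : sphere (0 : E3) 1 → E3) =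
      (3 : ℝ≥0∞) • (volume.restrict puncturedBall).map dir := by
  ext s hs
  rw [Measure.map_apply measurable_subtype_coe hs, Measure.smul_apply,
    Measure.map_apply measurable_dir hs, Measure.restrict_apply (measurable_dir hs),
    Measure.toSphere_apply' _ (measurable_subtype_coe hs)]
  have h : Ioo (0 : ℝ) 1 • (Subtype.val '' (Subtype.val ⁻¹' s : Set (sphere (0 : E3) 1))) =
      dir ⁻¹' s ∩ puncturedBall := by
    ext x
    simp only [Set.mem_smul, mem_image, mem_preimage, mem_inter_iff, mem_sdiff, mem_singleton_iff,
      mem_ball_zero_iff]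
    constructor
    · rintro ⟨c, hc, _, ⟨η, hη, rfl⟩, rfl⟩
      have hn : ‖(η : E3)‖ = 1 := by simp
      have h0 : (η : E3) ≠ 0 := norm_ne_zero_iff.1 (by rw [hn]; exact one_ne_zero)
      refine ⟨?_, ?_, smul_ne_zero hc.1.ne' h0⟩
      · rwa [dir_smul hc.1, dir_of_norm_eq_one hn]
      · rw [norm_smul, hn, mul_one, Real.norm_of_nonneg hc.1.le]
        exact hc.2
    · rintro ⟨hs, h1, h0⟩
      exact ⟨‖x‖, ⟨norm_pos_iff.2 h0, h1⟩, dir x, ⟨⟨dir x, by simp [norm_dir h0]⟩, hs, rfl⟩,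
        norm_smul_dir x⟩
  rw [h]
  simp

/-- Integration in polar coordinates of a function of the direction over the unit ball. -/
lemma lintegral_toSphere (g : E3 → ℝ≥0∞) (hg : Measurable g) :
    ∫⁻ η : sphere (0 : E3) 1, g η ∂(volume : Measure E3).toSphere =
      3 * ∫⁻ x in puncturedBall, g (dir x) := by
  rw [← lintegral_map hg measurable_subtype_coe, map_val_toSphere, lintegral_smul_measure,
    lintegral_map hg measurable_dir, smul_eq_mul]

end Polar

/-! ### Energy of sphere maps through their cone extensions -/

section Homogeneous

open scoped ENNReal

/-- `u` is a `C¹` map of the punctured space to the unit sphere that is constant on rays. -/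
structure IsSphereMap (u : E3 → E3) : Prop where
  contDiffOn : ContDiffOn ℝ 1 u {0}ᶜ
  smul_eq : ∀ s : ℝ, 0 < s → ∀ x, u (s • x) = u x
  norm_eq : ∀ x, x ≠ 0 → ‖u x‖ = 1

variable {u : E3 → E3}

lemma ne_zero_of_norm_eq_one {η : E3} (hη : ‖η‖ = 1) : η ≠ 0 :=
  norm_ne_zero_iff.1 (by rw [hη]; exact one_ne_zero)

namespace IsSphereMap

lemma differentiableAt (hu : IsSphereMap u) {x : E3} (hx : x ≠ 0) : DifferentiableAt ℝ u x :=
  (hu.contDiffOn.contDiffAt (isOpen_compl_singleton.mem_nhds hx)).differentiableAt (by simp)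

lemma differentiableAt_cone (hu : IsSphereMap u) {x : E3} (hx : x ≠ 0) :
    DifferentiableAt ℝ (fun x => ‖x‖ • u x) x :=
  (differentiableAt_id.norm ℝ hx).smul (hu.differentiableAt hx)

lemma continuousOn_fderiv (hu : IsSphereMap u) : ContinuousOn (fderiv ℝ u) {0}ᶜ :=
  hu.contDiffOn.continuousOn_fderiv_of_isOpen isOpen_compl_singleton le_rfl

lemma apply_dir (hu : IsSphereMap u) {x : E3} (hx : x ≠ 0) : u (dir x) = u x :=
  hu.smul_eq _ (inv_pos.2 (norm_pos_iff.2 hx)) x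

/-- The cone map is positively homogeneous of degree 1, so its derivative has degree 0: the Jacobian
on the ball is determined by its values on the unit sphere. -/
lemma fderiv_cone_smul (hu : IsSphereMap u) {s : ℝ} (hs : 0 < s) (x : E3) :
    fderiv ℝ (fun x => ‖x‖ • u x) (s • x) = fderiv ℝ (fun x => ‖x‖ • u x) x := by
  have h := fderiv_comp_smul (𝕜 := ℝ) (f := fun x => ‖x‖ • u x) (x := x) s
  have h' : (fun x => ‖s • x‖ • u (s • x)) = fun x => s • (‖x‖ • u x) := by
    funext y
    rw [hu.smul_eq s hs, norm_smul, Real.norm_of_nonneg hs.le, smul_smul]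
  rw [h', show (fun x => s • (‖x‖ • u x)) = s • (fun x => ‖x‖ • u x) from rfl,
    fderiv_const_smul_field] at h
  exact (smul_right_injective _ hs.ne' h).symm

lemma fderiv_cone_dir (hu : IsSphereMap u) {x : E3} (hx : x ≠ 0) :
    fderiv ℝ (fun x => ‖x‖ • u x) (dir x) = fderiv ℝ (fun x => ‖x‖ • u x) x :=
  hu.fderiv_cone_smul (inv_pos.2 (norm_pos_iff.2 hx)) x

lemma fderiv_apply_self (hu : IsSphereMap u) {x : E3} (hx : x ≠ 0) : fderiv ℝ u x x = 0 := by
  have h1 : HasDerivAt (fun s : ℝ => s • x) x 1 := by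
    simpa using (hasDerivAt_id (1 : ℝ)).smul_const x
  have h2 : HasFDerivAt u (fderiv ℝ u x) ((fun s : ℝ => s • x) 1) := by
    simpa using (hu.differentiableAt hx).hasFDerivAt
  have h3 := h2.comp_hasDerivAt (1 : ℝ) h1
  have h4 : HasDerivAt (u ∘ fun s : ℝ => s • x) 0 1 := by
    refine (hasDerivAt_const (1 : ℝ) (u x)).congr_of_eventuallyEq ?_
    filter_upwards [lt_mem_nhds (zero_lt_one' ℝ)] with s hs
    exact hu.smul_eq s hs x
  exact h3.unique h4

lemma inner_fderiv_apply (hu : IsSphereMap u) {x : E3} (hx : x ≠ 0) (v : E3) :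
    inner ℝ (u x) (fderiv ℝ u x v) = 0 := by
  have h := ((hu.differentiableAt hx).hasFDerivAt.norm_sq).congr_of_eventuallyEq
    (f₁ := fun _ => (1 : ℝ)) (by
      filter_upwards [isOpen_compl_singleton.mem_nhds hx] with y hy
      rw [hu.norm_eq y hy, one_pow])
  have h' := congrArg (fun L : E3 →L[ℝ] ℝ => L v) (h.unique (hasFDerivAt_const (1 : ℝ) x))
  simpa using h'

/-- The Jacobian of the conical extension is at most half the energy density. -/
lemma two_mul_abs_det_le (hu : IsSphereMap u) {η : E3} (hη : ‖η‖ = 1) :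
    2 * |(fderiv ℝ (fun x => ‖x‖ • u x) η).det| ≤ hsNormSq (fderiv ℝ u η) := by
  have h0 := ne_zero_of_norm_eq_one hη
  obtain ⟨b, rfl⟩ := exists_orthonormalBasis_zero_eq hη
  -- With `b 0` radial, the cone derivative sends `b 0` to the unit vector `u (b 0)` and agrees with
  -- `Du` on `b 1` and `b 2`, so only two factors remain in Hadamard's bound.
  have h := abs_det_le_prod_norm b (fderiv ℝ (fun x => ‖x‖ • u x) (b 0))
  simp only [fderiv_norm_smul_apply hη (hu.differentiableAt h0), Fin.prod_univ_three,
    b.inner_eq_ite, hu.fderiv_apply_self h0] at h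
  simp [hu.norm_eq _ h0] at h
  rw [hsNormSq_eq_sum b, Fin.sum_univ_three, hu.fderiv_apply_self h0]
  simp only [norm_zero]
  nlinarith [sq_nonneg (‖fderiv ℝ u (b 0) (b 1)‖ - ‖fderiv ℝ u (b 0) (b 2)‖)]

/-- Conformality makes the images of the two tangent basis vectors orthogonal and of equal length,
and both are orthogonal to `u η` because `‖u‖` is constant. Hence Hadamard and AM-GM are both
equalities. -/
lemma two_mul_abs_det_eq (hu : IsSphereMap u) {η : E3} (hη : ‖η‖ = 1)
    (hc : IsConformalMap (fderiv ℝ u η ∘L (ℝ ∙ η)ᗮ.subtypeL)) :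
    2 * |(fderiv ℝ (fun x => ‖x‖ • u x) η).det| = hsNormSq (fderiv ℝ u η) := by
  have h0 := ne_zero_of_norm_eq_one hη
  obtain ⟨b, rfl⟩ := exists_orthonormalBasis_zero_eq hη
  obtain ⟨c, hc0, hc⟩ := (isConformalMap_iff _).1 hc
  have hmem : ∀ i, i ≠ 0 → b i ∈ (ℝ ∙ b 0)ᗮ := fun i hi => by
    rw [Submodule.mem_orthogonal_singleton_iff_inner_right, b.inner_eq_ite, if_neg hi.symm]
  have hin : ∀ i j, i ≠ 0 → j ≠ 0 →
      inner ℝ (fderiv ℝ u (b 0) (b i)) (fderiv ℝ u (b 0) (b j)) = c * if i = j then 1 else 0 :=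
    fun i j hi hj => by
      have := hc ⟨b i, hmem i hi⟩ ⟨b j, hmem j hj⟩
      simpa [b.inner_eq_ite] using this
  have hn : ∀ i, i ≠ 0 → ‖fderiv ℝ u (b 0) (b i)‖ ^ 2 = c := fun i hi => by
    rw [← real_inner_self_eq_norm_sq, hin i i hi hi]
    simp
  have hval : ∀ i, fderiv ℝ (fun x => ‖x‖ • u x) (b 0) (b i) =
      if i = 0 then u (b 0) else fderiv ℝ u (b 0) (b i) := fun i => by
    rw [fderiv_norm_smul_apply hη (hu.differentiableAt h0), b.inner_eq_ite]
    by_cases hi : i = 0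
    · subst hi; simp [hu.fderiv_apply_self h0]
    · simp [hi, Ne.symm hi]
  rw [abs_det_eq_prod_norm b, hsNormSq_eq_sum b, Fin.prod_univ_three, Fin.sum_univ_three,
    hn 1 (by decide), hn 2 (by decide), hval, hval, hval, hu.fderiv_apply_self h0]
  · have h12 : ‖fderiv ℝ u (b 0) (b 1)‖ = ‖fderiv ℝ u (b 0) (b 2)‖ := by
      rw [← sq_eq_sq₀ (norm_nonneg _) (norm_nonneg _), hn 1 (by decide), hn 2 (by decide)]
    have h2 := hn 2 (by decide)
    simp [hu.norm_eq _ h0, h12]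
    linarith
  · intro i j hij
    simp only [hval]
    by_cases hi : i = 0
    · subst hi
      simp [hij.symm, hu.inner_fderiv_apply h0]
    · by_cases hj : j = 0
      · subst hj
        simp only [hi, if_false, if_true]
        rw [real_inner_comm, hu.inner_fderiv_apply h0]
      · simp [hi, hj, hin i j hi hj, hij]

lemma ofReal_integral_eq (hu : IsSphereMap u) :
    ENNReal.ofReal (∫ η : sphere (0 : E3) 1, hsNormSq (fderiv ℝ u η)
        ∂(volume : Measure E3).toSphere) =
      3 * ∫⁻ x in puncturedBall, ENNReal.ofReal (hsNormSq (fderiv ℝ u (dir x))) := by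
  have hc : Continuous fun η : sphere (0 : E3) 1 => hsNormSq (fderiv ℝ u η) :=
    continuous_hsNormSq.comp (hu.continuousOn_fderiv.comp_continuous continuous_subtype_val
      fun η => ne_zero_of_norm_eq_one (by simp))
  rw [ofReal_integral_eq_lintegral_ofReal
    (hc.integrable_of_hasCompactSupport (HasCompactSupport.of_compactSpace _))
    (.of_forall fun η => hsNormSq_nonneg _)]
  exact lintegral_toSphere (fun x => ENNReal.ofReal (hsNormSq (fderiv ℝ u x)))
    (continuous_hsNormSq.measurable.comp (measurable_fderiv ℝ u)).ennreal_ofReal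

lemma puncturedBall_subset_image (hu : IsSphereMap u)
    (hs : SurjOn u (sphere 0 1) (sphere 0 1)) :
    puncturedBall ⊆ (fun x => ‖x‖ • u x) '' puncturedBall := by
  rintro y ⟨hy, hy0 : y ≠ 0⟩
  obtain ⟨η, hη, hy'⟩ := hs (show dir y ∈ sphere (0 : E3) 1 by simp [norm_dir hy0])
  have hη : ‖η‖ = 1 := by simpa using hη
  have hp := norm_pos_iff.2 hy0
  refine ⟨‖y‖ • η, ⟨?_, smul_ne_zero hp.ne' (ne_zero_of_norm_eq_one hη)⟩, ?_⟩
  · simpa [norm_smul, hη] using hy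
  · simp only [hu.smul_eq _ hp, norm_smul, hη, hy', norm_norm, mul_one, norm_smul_dir]

lemma image_subset_puncturedBall (hu : IsSphereMap u) :
    (fun x => ‖x‖ • u x) '' puncturedBall ⊆ puncturedBall := by
  rintro _ ⟨x, ⟨hx, hx0 : x ≠ 0⟩, rfl⟩
  have hn : ‖(‖x‖ • u x)‖ = ‖x‖ := by simp [norm_smul, hu.norm_eq x hx0]
  refine ⟨by simpa [hn] using hx, ?_⟩
  rw [mem_singleton_iff, ← norm_eq_zero, hn, norm_eq_zero]
  exact hx0

lemma injOn_cone (hu : IsSphereMap u) (hi : InjOn u (sphere 0 1)) :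
    InjOn (fun x => ‖x‖ • u x) puncturedBall := by
  rintro x ⟨-, hx : x ≠ 0⟩ y ⟨-, hy : y ≠ 0⟩ (hxy : ‖x‖ • u x = ‖y‖ • u y)
  have hn : ‖x‖ = ‖y‖ := by
    simpa [norm_smul, hu.norm_eq x hx, hu.norm_eq y hy] using congrArg norm hxy
  rw [hn] at hxy
  have h := smul_right_injective _ (norm_ne_zero_iff.2 hy) hxy
  rw [← hu.apply_dir hx, ← hu.apply_dir hy] at h
  have h' := hi (by simp [norm_dir hx]) (by simp [norm_dir hy]) h
  rw [← norm_smul_dir x, ← norm_smul_dir y, h', hn]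

lemma six_mul_lintegral_det (u : E3 → E3) :
    3 * ∫⁻ x in puncturedBall, ENNReal.ofReal (2 * |(fderiv ℝ (fun x => ‖x‖ • u x) x).det|) =
      6 * ∫⁻ x in puncturedBall, ENNReal.ofReal |(fderiv ℝ (fun x => ‖x‖ • u x) x).det| := by
  simp_rw [ENNReal.ofReal_mul (zero_le_two (α := ℝ))]
  rw [lintegral_const_mul' _ _ ENNReal.ofReal_ne_top, ← mul_assoc]
  congr 1
  norm_num

lemma ofReal_eight_mul_pi :
    ENNReal.ofReal (8 * Real.pi) = 6 * ENNReal.ofReal (4 * Real.pi / 3) := by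
  rw [← ENNReal.ofReal_ofNat 6, ← ENNReal.ofReal_mul (by norm_num)]
  congr 1
  ring

/-- A `C¹` map of the unit sphere onto itself has energy at least `8π`. -/
theorem eight_mul_pi_le (hu : IsSphereMap u) (hs : SurjOn u (sphere 0 1) (sphere 0 1)) :
    8 * Real.pi ≤ ∫ η : sphere (0 : E3) 1, hsNormSq (fderiv ℝ u η)
      ∂(volume : Measure E3).toSphere := by
  rw [← ENNReal.ofReal_le_ofReal_iff (integral_nonneg fun η => hsNormSq_nonneg _),
    hu.ofReal_integral_eq, ofReal_eight_mul_pi, ← volume_puncturedBall]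
  calc 6 * volume puncturedBall
      ≤ 6 * volume ((fun x => ‖x‖ • u x) '' puncturedBall) := by
        gcongr
        exact hu.puncturedBall_subset_image hs
    _ ≤ 6 * ∫⁻ x in puncturedBall, ENNReal.ofReal |(fderiv ℝ (fun x => ‖x‖ • u x) x).det| := by
        gcongr
        -- Points covered several times only increase the integral, so injectivity is not needed
        -- here.
        exact addHaar_image_le_lintegral_abs_det_fderiv volume measurableSet_puncturedBall
          fun x hx => (hu.differentiableAt_cone hx.2).hasFDerivAt.hasFDerivWithinAt
    _ ≤ _ := by
        rw [← six_mul_lintegral_det]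
        gcongr 3 * ?_
        refine setLIntegral_mono' measurableSet_puncturedBall fun x hx => ?_
        rw [← hu.fderiv_cone_dir hx.2]
        exact ENNReal.ofReal_le_ofReal (hu.two_mul_abs_det_le (norm_dir hx.2))

/-- A conformal transformation of the unit sphere has energy `8π`. -/
theorem eq_eight_mul_pi (hu : IsSphereMap u) (hb : BijOn u (sphere 0 1) (sphere 0 1))
    (hc : ∀ x ∈ sphere (0 : E3) 1, IsConformalMap (fderiv ℝ u x ∘L (ℝ ∙ x)ᗮ.subtypeL)) :
    ∫ η : sphere (0 : E3) 1, hsNormSq (fderiv ℝ u η) ∂(volume : Measure E3).toSphere =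
      8 * Real.pi := by
  have hvol := lintegral_abs_det_fderiv_eq_addHaar_image volume measurableSet_puncturedBall
    (fun x hx => (hu.differentiableAt_cone hx.2).hasFDerivAt.hasFDerivWithinAt)
    (hu.injOn_cone hb.injOn)
  -- For a bijection the cone map permutes the punctured ball, so the area formula returns exactly
  -- its volume.
  rw [hu.image_subset_puncturedBall.antisymm (hu.puncturedBall_subset_image hb.surjOn)] at hvol
  rw [← ENNReal.ofReal_eq_ofReal_iff (integral_nonneg fun η => hsNormSq_nonneg _) (by positivity),
    hu.ofReal_integral_eq, ofReal_eight_mul_pi, ← volume_puncturedBall, ← hvol,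
    ← six_mul_lintegral_det]
  congr 1
  refine setLIntegral_congr_fun measurableSet_puncturedBall fun x hx => ?_
  rw [← hu.fderiv_cone_dir hx.2, hu.two_mul_abs_det_eq (norm_dir hx.2)
    (hc _ (by simp [norm_dir hx.2]))]

end IsSphereMap

end Homogeneous

/-! ### Images of concentric spheres meet every ray -/

section Topology

lemma isOpen_ring3 (r R : ℝ) : IsOpen (ring3 r R) :=
  (isOpen_lt continuous_const continuous_norm).inter (isOpen_lt continuous_norm continuous_const)

lemma ne_zero_of_mem_ring3 {r R : ℝ} (hr : 0 ≤ r) {x : E3} (hx : x ∈ ring3 r R) : x ≠ 0 :=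
  norm_pos_iff.1 (hr.trans_lt hx.1)

lemma smul_mem_ring3 {r R s : ℝ} (hr : 0 ≤ r) (hs : s ∈ Ioo r R) {η : E3} (hη : ‖η‖ = 1) :
    s • η ∈ ring3 r R := by
  have : ‖s • η‖ = s := by rw [norm_smul, hη, mul_one, Real.norm_of_nonneg (hr.trans hs.1.le)]
  exact ⟨by rw [this]; exact hs.1, by rw [this]; exact hs.2⟩

lemma isPreconnected_ring3 {r R : ℝ} (hr : 0 ≤ r) : IsPreconnected (ring3 r R) := by
  have hs : IsPreconnected (sphere (0 : E3) 1) :=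
    isPreconnected_sphere (by rw [← Module.finrank_eq_rank]; simp) 0 1
  have h := (isPreconnected_Ioo (a := r) (b := R)).prod hs |>.image
    (fun p : ℝ × E3 => p.1 • p.2) (by fun_prop)
  convert h using 1
  ext x
  constructor
  · intro hx
    exact ⟨(‖x‖, dir x), ⟨hx, by simp [norm_dir (ne_zero_of_mem_ring3 hr hx)]⟩, norm_smul_dir x⟩
  · rintro ⟨⟨s, η⟩, ⟨hs, hη⟩, rfl⟩
    exact smul_mem_ring3 hr hs (by simpa using hη)

/-- A continuous real function on a preconnected set that omits the value `t` stays on one side. -/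
lemma IsPreconnected.forall_lt_or_forall_gt {X : Type*} [TopologicalSpace X] {U : Set X}
    (hU : IsPreconnected U) {h : X → ℝ} (hh : ContinuousOn h U) {t : ℝ} (ht : ∀ y ∈ U, h y ≠ t) :
    (∀ y ∈ U, h y < t) ∨ ∀ y ∈ U, t < h y := by
  by_contra! hc
  obtain ⟨⟨y, hy, hyt⟩, z, hz, hzt⟩ := hc
  obtain ⟨w, hw, hwt⟩ := hU.intermediate_value hz hy hh ⟨hzt, hyt⟩
  exact ht w hw hwt

/-- A homeomorphism of spherical rings maps each concentric sphere to a surface that meets every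
ray. -/
theorem IsC1HomeoOn.exists_dir_eq {f : E3 → E3} {r R r' R' : ℝ} (hr : 0 ≤ r) (hr' : 0 ≤ r')
    (hf : IsC1HomeoOn f (ring3 r R) (ring3 r' R')) {t : ℝ} (ht : t ∈ Ioo r R) {η : E3}
    (hη : ‖η‖ = 1) : ∃ x, ‖x‖ = t ∧ dir (f x) = η := by
  set g := Function.invFunOn f (ring3 r R) with hg
  have hgA : ∀ y ∈ ring3 r' R', g y ∈ ring3 r R := fun y hy =>
    Function.invFunOn_mem (hf.bijOn.surjOn hy)
  have hfg : ∀ y ∈ ring3 r' R', f (g y) = y := fun y hy =>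
    Function.invFunOn_eq (hf.bijOn.surjOn hy)
  have hgf : ∀ x ∈ ring3 r R, g (f x) = x := hf.bijOn.injOn.leftInvOn_invFunOn
  have hgc : ContinuousOn (fun y => ‖g y‖) (ring3 r' R') := hf.continuousOn_inv.norm
  have ht0 : 0 < t := hr.trans_lt ht.1
  have hsub : sphere (0 : E3) t ⊆ ring3 r R := fun x hx => by
    have hx : ‖x‖ = t := by simpa using hx
    exact ⟨hx ▸ ht.1, hx ▸ ht.2⟩
  have hne : (sphere (0 : E3) t).Nonempty := ⟨t • η, by simp [norm_smul, hη, ht0.le]⟩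
  have hfn : ContinuousOn (fun x => ‖f x‖) (sphere 0 t) :=
    (hf.contDiffOn.continuousOn.mono hsub).norm
  obtain ⟨xa, hxa, hmin⟩ := (isCompact_sphere (0 : E3) t).exists_isMinOn hne hfn
  obtain ⟨xb, hxb, hmax⟩ := (isCompact_sphere (0 : E3) t).exists_isMaxOn hne hfn
  have ha := (hf.bijOn.mapsTo (hsub hxa)).1
  have hb := (hf.bijOn.mapsTo (hsub hxb)).2
  have hab : ‖f xa‖ ≤ ‖f xb‖ := hmin hxb
  set a := ‖f xa‖
  set b := ‖f xb‖
  -- The image of the sphere of radius `t` lies between the radii `a` and `b`, so `‖g‖ ≠ t` on the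
  -- two open rings outside this shell.
  have hat : ∀ y ∈ ring3 r' R', ‖g y‖ = t → a ≤ ‖y‖ ∧ ‖y‖ ≤ b := fun y hy hyt => by
    have hm : g y ∈ sphere (0 : E3) t := by simpa using hyt
    have h1 : a ≤ ‖f (g y)‖ := hmin hm
    have h2 : ‖f (g y)‖ ≤ b := hmax hm
    rw [hfg y hy] at h1 h2
    exact ⟨h1, h2⟩
  have hUB : ring3 r' a ⊆ ring3 r' R' := fun y hy => ⟨hy.1, hy.2.trans (hab.trans_lt hb)⟩
  have hVB : ring3 b R' ⊆ ring3 r' R' := fun y hy => ⟨(ha.trans_le hab).trans hy.1, hy.2⟩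
  have hU := (isPreconnected_ring3 hr').forall_lt_or_forall_gt (hgc.mono hUB)
    (t := t) fun y hy hyt => (hat y (hUB hy) hyt).1.not_gt hy.2
  have hV := (isPreconnected_ring3 (norm_nonneg (f xb))).forall_lt_or_forall_gt (hgc.mono hVB)
    (t := t) fun y hy hyt => (hat y (hVB hy) hyt).2.not_gt hy.1
  obtain ⟨s₁, hs₁⟩ := exists_between ha
  obtain ⟨s₂, hs₂⟩ := exists_between hb
  have hm₁ : s₁ • η ∈ ring3 r' a := smul_mem_ring3 hr' hs₁ hη
  have hm₂ : s₂ • η ∈ ring3 b R' := smul_mem_ring3 (norm_nonneg _) hs₂ hη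
  have hray : ∀ y ∈ (fun s : ℝ => s • η) '' Ioo r' R', y ∈ ring3 r' R' := by
    rintro _ ⟨s, hs, rfl⟩
    exact smul_mem_ring3 hr' hs hη
  have hrayc : IsPreconnected ((fun s : ℝ => s • η) '' Ioo r' R') :=
    isPreconnected_Ioo.image _ (by fun_prop)
  have hi₁ : s₁ • η ∈ (fun s : ℝ => s • η) '' Ioo r' R' :=
    ⟨s₁, ⟨hs₁.1, hs₁.2.trans (hab.trans_lt hb)⟩, rfl⟩
  have hi₂ : s₂ • η ∈ (fun s : ℝ => s • η) '' Ioo r' R' :=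
    ⟨s₂, ⟨(ha.trans_le hab).trans hs₂.1, hs₂.2⟩, rfl⟩
  have hfin : (∃ y ∈ (fun s : ℝ => s • η) '' Ioo r' R', ‖g y‖ = t) →
      ∃ x, ‖x‖ = t ∧ dir (f x) = η := by
    rintro ⟨_, ⟨s, hs, rfl⟩, hyt⟩
    refine ⟨g (s • η), hyt, ?_⟩
    rw [hfg _ (smul_mem_ring3 hr' hs hη), dir_smul (hr'.trans_lt hs.1), dir_of_norm_eq_one hη]
  -- the closed shell containing the image of the sphere
  have hKB : closedBall (0 : E3) b \ ball 0 a ⊆ ring3 r' R' := fun y hy => by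
    simp only [mem_sdiff, mem_closedBall_zero_iff, mem_ball_zero_iff, not_lt] at hy
    exact ⟨ha.trans_le hy.2, hy.1.trans_lt hb⟩
  have hK : IsCompact (closedBall (0 : E3) b \ ball 0 a) :=
    (isCompact_closedBall (0 : E3) b).diff isOpen_ball
  have hKne : (closedBall (0 : E3) b \ ball 0 a).Nonempty := ⟨f xa, by simpa using hab, by simp [a]⟩
  have hcase : ∀ x ∈ ring3 r R, f x ∈ ring3 r' a ∨ f x ∈ ring3 b R' ∨
      f x ∈ closedBall (0 : E3) b \ ball 0 a := fun x hx => by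
    have hfx := hf.bijOn.mapsTo hx
    rcases lt_or_ge ‖f x‖ a with h | h
    · exact Or.inl ⟨hfx.1, h⟩
    · rcases lt_or_ge b ‖f x‖ with h' | h'
      · exact Or.inr (Or.inl ⟨h', hfx.2⟩)
      · exact Or.inr (Or.inr ⟨by simpa using h', by simpa using h⟩)
  rcases hU with hU | hU <;> rcases hV with hV | hV
  · exfalso
    -- Here `‖g‖` is below `t` off the shell and attains a maximum below `R` on it. A point of the
    -- domain with radius `s` above both bounds cannot be a value of `g`.
    obtain ⟨ym, hym, hM⟩ := hK.exists_isMaxOn hKne (hgc.mono hKB)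
    obtain ⟨s, hs⟩ := exists_between (max_lt (hgA ym (hKB hym)).2 ht.2)
    have hst : t < s := (le_max_right _ _).trans_lt hs.1
    have hsx : s • η ∈ ring3 r R := smul_mem_ring3 hr ⟨ht.1.trans hst, hs.2⟩ hη
    have hn : ‖s • η‖ = s := by rw [norm_smul, hη, mul_one, Real.norm_of_nonneg (ht0.trans hst).le]
    rcases hcase _ hsx with h | h | h
    · have := hU _ h
      rw [hgf _ hsx, hn] at this
      exact this.not_gt hst
    · have := hV _ h
      rw [hgf _ hsx, hn] at this
      exact this.not_gt hst
    · have : ‖g (f (s • η))‖ ≤ ‖g ym‖ := hM h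
      rw [hgf _ hsx, hn] at this
      exact this.not_gt ((le_max_left _ _).trans_lt hs.1)
  -- Opposite signs at the two ends: the intermediate value theorem along the ray through `η` gives
  -- a point where `‖g‖ = t`.
  · obtain ⟨w, hw, hwt⟩ := hrayc.intermediate_value hi₁ hi₂ (hgc.mono hray)
      ⟨(hU _ hm₁).le, (hV _ hm₂).le⟩
    exact hfin ⟨w, hw, hwt⟩
  · obtain ⟨w, hw, hwt⟩ := hrayc.intermediate_value hi₂ hi₁ (hgc.mono hray)
      ⟨(hV _ hm₂).le, (hU _ hm₁).le⟩
    exact hfin ⟨w, hw, hwt⟩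
  · exfalso
    obtain ⟨ym, hym, hM⟩ := hK.exists_isMinOn hKne (hgc.mono hKB)
    obtain ⟨s, hs⟩ := exists_between (lt_min (hgA ym (hKB hym)).1 ht.1)
    have hst : s < t := hs.2.trans_le (min_le_right _ _)
    have hsx : s • η ∈ ring3 r R := smul_mem_ring3 hr ⟨hs.1, hst.trans ht.2⟩ hη
    have hn : ‖s • η‖ = s := by rw [norm_smul, hη, mul_one, Real.norm_of_nonneg (hr.trans hs.1.le)]
    rcases hcase _ hsx with h | h | h
    · have := hU _ h
      rw [hgf _ hsx, hn] at this
      exact this.not_gt hst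
    · have := hV _ h
      rw [hgf _ hsx, hn] at this
      exact this.not_gt hst
    · have : ‖g ym‖ ≤ ‖g (f (s • η))‖ := hM h
      rw [hgf _ hsx, hn] at this
      exact this.not_gt (hs.2.trans_le (min_le_left _ _))

end Topology

/-! ### Scaling to the unit sphere and the lower bound -/

section Energy

variable {f : E3 → E3} {r R r' R' : ℝ}

lemma IsC1HomeoOn.contDiffOn_sphericalPart (hr' : 0 ≤ r')
    (hf : IsC1HomeoOn f (ring3 r R) (ring3 r' R')) :
    ContDiffOn ℝ 1 (sphericalPart f) (ring3 r R) :=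
  contDiffOn_dir.comp hf.contDiffOn fun _ hx => ne_zero_of_mem_ring3 hr' (hf.bijOn.mapsTo hx)

lemma IsC1HomeoOn.isSphereMap (hr : 0 ≤ r) (hr' : 0 ≤ r')
    (hf : IsC1HomeoOn f (ring3 r R) (ring3 r' R')) {t : ℝ} (ht : t ∈ Ioo r R) :
    IsSphereMap fun x => sphericalPart f (t • dir x) where
  contDiffOn := (hf.contDiffOn_sphericalPart hr').comp (contDiffOn_dir.const_smul t)
    fun _ hx => smul_mem_ring3 hr ht (norm_dir hx)
  smul_eq s hs x := by rw [dir_smul hs]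
  norm_eq x hx := norm_dir (ne_zero_of_mem_ring3 hr'
    (hf.bijOn.mapsTo (smul_mem_ring3 hr ht (norm_dir hx))))

lemma fderiv_comp_smul_dir_apply {S : E3 → E3} {t : ℝ} {η : E3} (hη : ‖η‖ = 1)
    (hS : DifferentiableAt ℝ S (t • η)) (v : E3) :
    fderiv ℝ (fun x => S (t • dir x)) η v =
      t • fderiv ℝ S (t • η) (v - inner ℝ η v • η) := by
  have h1 : HasFDerivAt (fun x => t • dir x) (t • fderiv ℝ dir η) η :=
    (differentiableAt_dir (ne_zero_of_norm_eq_one hη)).hasFDerivAt.const_smul t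
  have h2 : HasFDerivAt S (fderiv ℝ S (t • η)) (t • dir η) := by
    rw [dir_of_norm_eq_one hη]
    exact hS.hasFDerivAt
  have h3 : HasFDerivAt (fun x => S (t • dir x)) _ η := h2.comp η h1
  rw [h3.fderiv]
  simp [fderiv_dir_apply hη]

/-- Precomposing with `t • dir` kills the radial derivative and multiplies tangential ones by `t`.
The resulting `t ^ 2` is exactly the area factor in `sphereMeasure`. -/
lemma hsNormSq_fderiv_comp_smul_dir {S : E3 → E3} {t : ℝ} {η : E3} (hη : ‖η‖ = 1)
    (hS : DifferentiableAt ℝ S (t • η)) :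
    hsNormSq (fderiv ℝ (fun x => S (t • dir x)) η) =
      t ^ 2 * (hsNormSq (fderiv ℝ S (t • η)) - ‖fderiv ℝ S (t • η) η‖ ^ 2) := by
  obtain ⟨b, rfl⟩ := exists_orthonormalBasis_zero_eq hη
  simp only [hsNormSq_eq_sum b, Fin.sum_univ_three, fderiv_comp_smul_dir_apply hη hS, b.inner_eq_ite]
  simp [norm_smul, mul_pow]
  ring

lemma integral_sphereMeasure {t : ℝ} (ht : 0 < t) (g : E3 → ℝ) :
    ∫ x, g x ∂(sphereMeasure t) =
      t ^ 2 * ∫ η : sphere (0 : E3) 1, g (t • (η : E3)) ∂(volume : Measure E3).toSphere := by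
  have he : MeasurableEmbedding fun η : sphere (0 : E3) 1 => t • (η : E3) := by
    refine (Continuous.isClosedEmbedding (by fun_prop) fun η ζ h => ?_).measurableEmbedding
    exact Subtype.ext (smul_right_injective _ ht.ne' h)
  rw [sphereMeasure, integral_smul_measure, he.integral_map, ENNReal.toReal_ofReal (sq_nonneg t),
    smul_eq_mul]

lemma IsC1HomeoOn.tangentialEnergy_eq (hr : 0 ≤ r) (hr' : 0 ≤ r')
    (hf : IsC1HomeoOn f (ring3 r R) (ring3 r' R')) {t : ℝ} (ht : t ∈ Ioo r R) :
    tangentialEnergy f t = ∫ η : sphere (0 : E3) 1,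
      hsNormSq (fderiv ℝ (fun x => sphericalPart f (t • dir x)) η)
        ∂(volume : Measure E3).toSphere := by
  have ht0 : 0 < t := hr.trans_lt ht.1
  rw [tangentialEnergy, integral_sphereMeasure ht0, ← integral_const_mul]
  congr 1
  funext η
  have hη : ‖(η : E3)‖ = 1 := by simp
  have hS : DifferentiableAt ℝ (sphericalPart f) (t • (η : E3)) :=
    ((hf.contDiffOn_sphericalPart hr').contDiffAt
      ((isOpen_ring3 r R).mem_nhds (smul_mem_ring3 hr ht hη))).differentiableAt (by simp)
  rw [hsNormSq_fderiv_comp_smul_dir hη hS, dir_smul ht0, dir_of_norm_eq_one hη]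

theorem IsC1HomeoOn.eight_mul_pi_le_tangentialEnergy (hr : 0 ≤ r) (hr' : 0 ≤ r')
    (hf : IsC1HomeoOn f (ring3 r R) (ring3 r' R')) {t : ℝ} (ht : t ∈ Ioo r R) :
    8 * Real.pi ≤ tangentialEnergy f t := by
  have ht0 : 0 < t := hr.trans_lt ht.1
  rw [hf.tangentialEnergy_eq hr hr' ht]
  refine (hf.isSphereMap hr hr' ht).eight_mul_pi_le fun η hη => ?_
  obtain ⟨x, hxt, hx⟩ := hf.exists_dir_eq hr hr' ht (η := η) (by simpa using hη)
  have hx0 : x ≠ 0 := norm_pos_iff.1 (hxt ▸ ht0)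
  refine ⟨dir x, by simp [norm_dir hx0], ?_⟩
  simp only [dir_of_norm_eq_one (norm_dir hx0)]
  rw [← hxt, norm_smul_dir]
  exact hx

end Energy

/-! ### Generalized radial maps and equality -/

section GeneralizedRadial

variable {T : E3 → E3}

lemma IsSphereConformal.norm_apply (hT : IsSphereConformal T) {η : E3} (hη : ‖η‖ = 1) :
    ‖T η‖ = 1 := by
  simpa using hT.bijOn.mapsTo (show η ∈ sphere (0 : E3) 1 by simpa using hη)

theorem IsSphereConformal.tangentialEnergy_eq (hT : IsSphereConformal T) {r R r' R' : ℝ}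
    (hr : 0 ≤ r) (hr' : 0 ≤ r') {f : E3 → E3} (hf : IsC1HomeoOn f (ring3 r R) (ring3 r' R'))
    {ρ : ℝ → ℝ} (hfT : ∀ x ∈ ring3 r R, f x = ρ ‖x‖ • T (dir x)) {t : ℝ} (ht : t ∈ Ioo r R) :
    tangentialEnergy f t = 8 * Real.pi := by
  have ht0 : 0 < t := hr.trans_lt ht.1
  have hval : ∀ η : E3, ‖η‖ = 1 → f (t • η) = ρ t • T η := fun η hη => by
    rw [hfT _ (smul_mem_ring3 hr ht hη), dir_smul ht0, dir_of_norm_eq_one hη, norm_smul, hη,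
      mul_one, Real.norm_of_nonneg ht0.le]
  obtain ⟨η₀, hη₀⟩ : ∃ η : E3, ‖η‖ = 1 := ⟨EuclideanSpace.single 0 1, by simp⟩
  have hρ : ρ t ≠ 0 := fun h0 =>
    ne_zero_of_mem_ring3 hr' (hf.bijOn.mapsTo (smul_mem_ring3 hr ht hη₀))
      (by rw [hval _ hη₀, h0, zero_smul])
  -- The profile `ρ` may be negative, so the spherical part is `T` only up to the sign `σ`;
  -- multiplying by `σ` preserves bijectivity and conformality.
  set σ : ℝ := |ρ t|⁻¹ * ρ t with hσ
  have hσ0 : σ ≠ 0 := mul_ne_zero (inv_ne_zero (abs_ne_zero.2 hρ)) hρ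
  have hσ1 : |σ| = 1 := by
    rw [hσ, abs_mul, abs_inv, abs_abs, inv_mul_cancel₀ (abs_ne_zero.2 hρ)]
  have hu : ∀ x : E3, x ≠ 0 → sphericalPart f (t • dir x) = σ • T (dir x) := fun x hx => by
    rw [sphericalPart, hval _ (norm_dir hx), dir, norm_smul, hT.norm_apply (norm_dir hx), mul_one,
      Real.norm_eq_abs, smul_smul]
  have huS : ∀ η ∈ sphere (0 : E3) 1, sphericalPart f (t • dir η) = σ • T η := fun η hη => by
    have hη : ‖η‖ = 1 := by simpa using hη
    rw [hu η (ne_zero_of_norm_eq_one hη), dir_of_norm_eq_one hη]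
  rw [hf.tangentialEnergy_eq hr hr' ht]
  refine (hf.isSphereMap hr hr' ht).eq_eight_mul_pi ⟨fun η hη => ?_, fun η hη ζ hζ h => ?_,
    fun y hy => ?_⟩ fun x hx => ?_
  · have := hT.norm_apply (η := η) (by simpa using hη)
    simp only [huS η hη]
    simp [norm_smul, hσ1, this]
  · simp only [huS η hη, huS ζ hζ] at h
    exact hT.bijOn.injOn hη hζ (smul_right_injective _ hσ0 h)
  · have hy : ‖y‖ = 1 := by simpa using hy
    obtain ⟨η, hη, hηy⟩ := hT.bijOn.surjOn
      (show σ⁻¹ • y ∈ sphere (0 : E3) 1 by simp [norm_smul, hσ1, hy])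
    exact ⟨η, hη, by simp only [huS η hη]; rw [hηy, smul_inv_smul₀ hσ0]⟩
  · have hx0 : x ≠ 0 := ne_zero_of_norm_eq_one (by simpa using hx)
    have he : fderiv ℝ (fun x => sphericalPart f (t • dir x)) x =
        σ • fderiv ℝ (fun y => T (dir y)) x := by
      have h := fderiv_const_smul_field (𝕜 := ℝ) (f := fun y => T (dir y)) σ
      refine (Filter.EventuallyEq.fderiv_eq ?_).trans (congrFun h x)
      filter_upwards [isOpen_compl_singleton.mem_nhds hx0] with y hy
      exact hu y hy
    rw [he, ContinuousLinearMap.smul_comp]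
    exact (hT.conformal x hx).smul hσ0

lemma isSphereConformal_id : IsSphereConformal id where
  bijOn := bijOn_id _
  contDiffOn := contDiffOn_dir
  conformal x hx := by
    have hx : ‖x‖ = 1 := by simpa using hx
    rw [isConformalMap_iff]
    refine ⟨1, one_pos, fun v w => ?_⟩
    have h : ∀ v : (ℝ ∙ x)ᗮ, fderiv ℝ (fun y => id (dir y)) x v = v := fun v => by
      have hv : inner ℝ x (v : E3) = 0 :=
        Submodule.mem_orthogonal_singleton_iff_inner_right.1 v.2
      change fderiv ℝ dir x v = v
      rw [fderiv_dir_apply hx, hv, zero_smul, sub_zero]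
    simp only [ContinuousLinearMap.comp_apply, Submodule.subtypeL_apply, h, one_mul,
      Submodule.coe_inner]

/-- A continuous bijection of the unit sphere has a continuous inverse. -/
lemma continuousOn_invFunOn_sphere (hb : BijOn T (sphere 0 1) (sphere 0 1))
    (hc : ContinuousOn T (sphere 0 1)) :
    ContinuousOn (Function.invFunOn T (sphere 0 1)) (sphere 0 1) := by
  have hmaps : MapsTo (Function.invFunOn T (sphere 0 1)) (sphere 0 1) (sphere 0 1) := fun y hy =>
    Function.invFunOn_mem (hb.surjOn hy)
  have hinv := hb.invOn_invFunOn
  rw [continuousOn_iff_isClosed]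
  intro C hC
  -- The preimage of `C` under the inverse is an image under `T` of a compact set, hence closed.
  refine ⟨T '' (C ∩ sphere 0 1), ?_, ?_⟩
  · exact (((isCompact_sphere (0 : E3) 1).inter_left hC).image_of_continuousOn
      (hc.mono inter_subset_right)).isClosed
  · ext y
    constructor
    · rintro ⟨hy, hyS⟩
      exact ⟨⟨_, ⟨hy, hmaps hyS⟩, hinv.2 hyS⟩, hyS⟩
    · rintro ⟨⟨x, ⟨hxC, hxS⟩, rfl⟩, hyS⟩
      exact ⟨by rw [mem_preimage, hinv.1 hxS]; exact hxC, hyS⟩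

/-- The increasing affine bijection of `(r, R)` onto `(r', R')` induces a generalized radial map. -/
theorem IsSphereConformal.isC1HomeoOn (hT : IsSphereConformal T) {r R r' R' : ℝ} (hr : 0 ≤ r)
    (hrR : r < R) (hr' : 0 ≤ r') (hrR' : r' < R') :
    IsC1HomeoOn (fun x => (r' + (R' - r') / (R - r) * (‖x‖ - r)) • T (dir x))
      (ring3 r R) (ring3 r' R') := by
  set k := (R' - r') / (R - r) with hk
  have hk0 : 0 < k := div_pos (sub_pos.2 hrR') (sub_pos.2 hrR)
  have hkR : k * (R - r) = R' - r' := div_mul_cancel₀ _ (sub_pos.2 hrR).ne'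
  have hρ : ∀ s ∈ Ioo r R, r' + k * (s - r) ∈ Ioo r' R' := fun s hs => by
    constructor
    · have := mul_pos hk0 (sub_pos.2 hs.1)
      linarith
    · have := mul_lt_mul_of_pos_left (sub_lt_sub_right hs.2 r) hk0
      linarith
  have hρi : ∀ s ∈ Ioo r' R', r + k⁻¹ * (s - r') ∈ Ioo r R := fun s hs => by
    have h1 : k⁻¹ * (R' - r') = R - r := by rw [← hkR, inv_mul_cancel_left₀ hk0.ne']
    constructor
    · have := mul_pos (inv_pos.2 hk0) (sub_pos.2 hs.1)
      linarith
    · have := mul_lt_mul_of_pos_left (sub_lt_sub_right hs.2 r') (inv_pos.2 hk0)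
      linarith
  set τ := Function.invFunOn T (sphere 0 1)
  have hτ : InvOn τ T (sphere 0 1) (sphere 0 1) := hT.bijOn.invOn_invFunOn
  have hτm : ∀ η : E3, ‖η‖ = 1 → ‖τ η‖ = 1 := fun η hη => by
    simpa using Function.invFunOn_mem (hT.bijOn.surjOn (show η ∈ sphere (0 : E3) 1 by simpa using hη))
  set f : E3 → E3 := fun x => (r' + k * (‖x‖ - r)) • T (dir x) with hf
  set g : E3 → E3 := fun y => (r + k⁻¹ * (‖y‖ - r')) • τ (dir y) with hg
  have hfm : MapsTo f (ring3 r R) (ring3 r' R') := fun x hx =>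
    smul_mem_ring3 hr' (hρ _ hx) (hT.norm_apply (norm_dir (ne_zero_of_mem_ring3 hr hx)))
  have hgm : MapsTo g (ring3 r' R') (ring3 r R) := fun y hy =>
    smul_mem_ring3 hr (hρi _ hy) (hτm _ (norm_dir (ne_zero_of_mem_ring3 hr' hy)))
  have hnorm : ∀ s : ℝ, 0 < s → ∀ η : E3, ‖η‖ = 1 → ‖s • η‖ = s ∧ dir (s • η) = η :=
    fun s hs η hη => ⟨by rw [norm_smul, hη, mul_one, Real.norm_of_nonneg hs.le],
      by rw [dir_smul hs, dir_of_norm_eq_one hη]⟩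
  have hgf : LeftInvOn g f (ring3 r R) := fun x hx => by
    have hd := norm_dir (ne_zero_of_mem_ring3 hr hx)
    obtain ⟨h1, h2⟩ := hnorm _ (hr'.trans_lt (hρ _ hx).1) _ (hT.norm_apply hd)
    simp only [hf, hg, h1, h2]
    rw [hτ.1 (by simpa using hd), add_sub_cancel_left, inv_mul_cancel_left₀ hk0.ne',
      add_sub_cancel, norm_smul_dir]
  have hfg : RightInvOn g f (ring3 r' R') := fun y hy => by
    have hd := norm_dir (ne_zero_of_mem_ring3 hr' hy)
    obtain ⟨h1, h2⟩ := hnorm _ (hr.trans_lt (hρi _ hy).1) _ (hτm _ hd)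
    simp only [hf, hg, h1, h2]
    rw [hτ.2 (by simpa using hd), add_sub_cancel_left, mul_inv_cancel_left₀ hk0.ne',
      add_sub_cancel, norm_smul_dir]
  have hbij : BijOn f (ring3 r R) (ring3 r' R') := InvOn.bijOn ⟨hgf, hfg⟩ hfm hgm
  have hTc : ContinuousOn T (sphere 0 1) := by
    refine (hT.contDiffOn.continuousOn.mono fun η hη => ?_).congr fun η hη => ?_
    · exact ne_zero_of_norm_eq_one (by simpa using hη)
    · simp only [dir_of_norm_eq_one (show ‖η‖ = 1 by simpa using hη)]
  refine ⟨?_, hbij, ?_⟩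
  · intro x hx
    have hx0 := ne_zero_of_mem_ring3 hr hx
    have hρd : ContDiffAt ℝ 1 (fun x : E3 => r' + k * (‖x‖ - r)) x :=
      contDiffAt_const.add (contDiffAt_const.mul ((contDiffAt_norm ℝ hx0).sub contDiffAt_const))
    exact (hρd.smul
      (hT.contDiffOn.contDiffAt (isOpen_compl_singleton.mem_nhds hx0))).contDiffWithinAt
  · have hgc : ContinuousOn g (ring3 r' R') := by
      have hρc : ContinuousOn (fun y : E3 => r + k⁻¹ * (‖y‖ - r')) (ring3 r' R') := by fun_prop
      refine hρc.smul ?_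
      refine (continuousOn_invFunOn_sphere hT.bijOn hTc).comp
        (continuousOn_dir.mono fun y hy => ne_zero_of_mem_ring3 hr' hy) fun y hy => ?_
      simp [norm_dir (ne_zero_of_mem_ring3 hr' hy)]
    -- `IsC1HomeoOn` refers to `Function.invFunOn f`, which coincides with the explicit inverse `g`
    -- on the target ring by injectivity of `f`.
    refine hgc.congr fun y hy => ?_
    exact hbij.injOn (Function.invFunOn_mem (hbij.surjOn hy)) (hgm hy)
      ((Function.invFunOn_eq (hbij.surjOn hy)).trans (hfg hy).symm)

end GeneralizedRadial

theorem lemma4p1 (r R r' R' : ℝ) (hr : 0 ≤ r) (hrR : r < R) (hr' : 0 ≤ r') (hrR' : r' < R') :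
    -- the inequality
    (∀ f : E3 → E3, IsC1HomeoOn f (ring3 r R) (ring3 r' R') →
      ∀ t ∈ Ioo r R, 8 * Real.pi ≤ tangentialEnergy f t) ∧
    -- it is sharp
    (∃ f : E3 → E3, IsC1HomeoOn f (ring3 r R) (ring3 r' R') ∧
      ∀ t ∈ Ioo r R, tangentialEnergy f t = 8 * Real.pi) ∧
    -- it is attained for every generalized radial map
    (∀ (T : E3 → E3) (ρ : ℝ → ℝ) (f : E3 → E3), IsSphereConformal T →
      IsC1HomeoOn f (ring3 r R) (ring3 r' R') →
      (∀ x ∈ ring3 r R, f x = ρ ‖x‖ • T (dir x)) →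
      ∀ t ∈ Ioo r R, tangentialEnergy f t = 8 * Real.pi) ∧
    -- every conformal `T` occurs in such a map
    (∀ T : E3 → E3, IsSphereConformal T →
      ∃ ρ : ℝ → ℝ, IsC1HomeoOn (fun x => ρ ‖x‖ • T (dir x)) (ring3 r R) (ring3 r' R')) := by
  refine ⟨fun f hf t ht => hf.eight_mul_pi_le_tangentialEnergy hr hr' ht,
    ⟨_, isSphereConformal_id.isC1HomeoOn hr hrR hr' hrR', fun t ht => ?_⟩,
    fun T ρ f hT hf hfT t ht => hT.tangentialEnergy_eq hr hr' hf hfT ht,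
    fun T hT => ⟨fun s => r' + (R' - r') / (R - r) * (s - r), hT.isC1HomeoOn hr hrR hr' hrR'⟩⟩
  -- Sharpness is witnessed by `T = id` with the affine profile.
  exact isSphereConformal_id.tangentialEnergy_eq hr hr'
    (isSphereConformal_id.isC1HomeoOn hr hrR hr' hrR')
    (ρ := fun s => r' + (R' - r') / (R - r) * (s - r)) (fun x _ => rfl) ht
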